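/- Let $d\ge 2$ and let $q:\mathbb{R}^d\to(0,\infty)$ be a radial probability density; write also $q$ for its radial profile on $[0,\infty)$, so that $q(x)=q(|x|)$. A function $f$ defined on $(0,\infty)$ and positive near infinity is regularly varying with exponent $\alpha\in\mathbb{R}$, written $f\in RV_\alpha$, if $\lim_{R\to\infty} f(tR)/f(R)=t^\alpha$ for every $t>0$. Suppose that $q$ has subexponential decay, that is, at least one of the following holds: (i) (heavy tail) $q\in RV_{-\alpha}$ for some $\alpha>d$; (ii) (light tail with $\psi\in RV_v$, $0<v<1$) $q(x)=L(|x|)\exp(-\psi(|x|))$ for all $x\in\mathbb{R}^d$, where $L\in RV_\alpha$ for some $\alpha\in\mathbb{R}$, $\psi\in C^2([0,\infty);[0,\infty))$ is of von Mises type (that is, $\psi'(z)>0$ for all large $z$, $\psi(z)\to\infty$ and $(1/\psi')'(z)\to 0$ as $z\to\infty$), $\psi'$ is monotone on some half-line $[z_0,\infty)$, and $\psi\in RV_v$ for some $v\in(0,1)$. For every $n$ let $\mathcal P_n=\{x_1,\dots,x_N\}$ be the Poisson point process of intensity $nq$: $N$ has the Poisson law with parameter $n$ and is independent of the points $x_i$,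 which are i.i.d. with density $q$. For $r>0$ let $G(\mathcal P_n,r)$ be the graph with vertex set $\mathcal P_n$ in which two distinct points are joined by an edge if their distance is less than $r$. Then $$\lim_{n\to\infty}\mathbb P\big(G(\mathcal P_n,1)\text{ is disconnected}\big)=1,$$ and, more generally, for every sequence $(r_n)$ with $0<r_n\le 1$, $$\lim_{n\to\infty}\mathbb P\big(G(\mathcal P_n,r_n)\text{ is disconnected}\big)=1.$$ -/

import Mathlib

open Filter Topology MeasureTheory ProbabilityTheory

namespace RGG

/-- Regular variation at infinity with exponent `α`. It is a tail property, so positivity is asked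
only near infinity; for a positive function on `(0, ∞)` this is the usual definition. -/
def RegularlyVarying (f : ℝ → ℝ) (α : ℝ) : Prop :=
  (∀ᶠ R in atTop, 0 < f R) ∧
    ∀ t : ℝ, 0 < t → Tendsto (fun R : ℝ => f (t * R) / f R) atTop (𝓝 (t ^ α))

/-- `f` is radial: `f x` depends on `‖x‖` only. -/
def IsRadial {d : ℕ} (f : EuclideanSpace ℝ (Fin d) → ℝ) : Prop :=
  ∀ x y, ‖x‖ = ‖y‖ → f x = f y

/-- `f` is the radial profile of `q`. Only the values of `f` on `[0, ∞)` matter. -/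
def IsRadialProfile {d : ℕ} (q : EuclideanSpace ℝ (Fin d) → ℝ) (f : ℝ → ℝ) : Prop :=
  ∀ x, f ‖x‖ = q x

/-- A radial, everywhere positive probability density on `ℝ^d`. -/
structure IsRadialDensity {d : ℕ} (q : EuclideanSpace ℝ (Fin d) → ℝ) : Prop where
  measurable : Measurable q
  pos : ∀ x, 0 < q x
  lintegral_eq_one : ∫⁻ x, ENNReal.ofReal (q x) = 1
  radial : IsRadial q

/-- The probability measure with density `q` with respect to Lebesgue measure. -/
noncomputable def densityMeasure {d : ℕ} (q : EuclideanSpace ℝ (Fin d) → ℝ) :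
    Measure (EuclideanSpace ℝ (Fin d)) :=
  volume.withDensity fun x => ENNReal.ofReal (q x)

/-- Heavy tail: the radial profile of `q` is regularly varying with exponent `-α`, `α > d`. -/
def HasHeavyTail {d : ℕ} (q : EuclideanSpace ℝ (Fin d) → ℝ) : Prop :=
  ∃ (f : ℝ → ℝ) (α : ℝ), IsRadialProfile q f ∧ (d : ℝ) < α ∧ RegularlyVarying f (-α)

/-- Functions `ψ ∈ C²([0, ∞); [0, ∞))` of von Mises type. -/
structure IsVonMises (ψ : ℝ → ℝ) : Prop where
  contDiffOn : ContDiffOn ℝ 2 ψ (Set.Ici 0)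
  nonneg : ∀ z, 0 ≤ z → 0 ≤ ψ z
  deriv_pos : ∀ᶠ z in atTop, 0 < deriv ψ z
  tendsto_atTop : Tendsto ψ atTop atTop
  tendsto_deriv : Tendsto (deriv fun z => 1 / deriv ψ z) atTop (𝓝 0)

/-- `f` is monotone (in either direction) on some half-line `[z₀, ∞)`. -/
def EventuallyMonotone (f : ℝ → ℝ) : Prop :=
  ∃ z₀ : ℝ, MonotoneOn f (Set.Ici z₀) ∨ AntitoneOn f (Set.Ici z₀)

/-- `q(x) = L(|x|) exp(-ψ(|x|))` is a light tail representation of `q` with exponent function `ψ`: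
`ψ` is of von Mises type, `ψ'` is eventually monotone, and `L` is regularly varying. -/
def HasLightTailWith {d : ℕ} (q : EuclideanSpace ℝ (Fin d) → ℝ) (ψ : ℝ → ℝ) : Prop :=
  IsVonMises ψ ∧ EventuallyMonotone (deriv ψ) ∧
    ∃ (L : ℝ → ℝ) (α : ℝ), RegularlyVarying L α ∧ ∀ x, q x = L ‖x‖ * Real.exp (-ψ ‖x‖)

/-- Subexponential decay: a heavy tail, or a light tail with `ψ` regularly varying with
exponent `v ∈ (0, 1)`. -/
def HasSubexponentialDecay {d : ℕ} (q : EuclideanSpace ℝ (Fin d) → ℝ) : Prop :=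
  HasHeavyTail q ∨
    ∃ (ψ : ℝ → ℝ) (v : ℝ), HasLightTailWith q ψ ∧ 0 < v ∧ v < 1 ∧ RegularlyVarying ψ v

/-- The random set `{x₁, …, x_N}`, the points being indexed by `i < N` here. -/
def pointSet {Ω E : Type*} (N : Ω → ℕ) (X : ℕ → Ω → E) (ω : Ω) : Set E :=
  {p | ∃ i, i < N ω ∧ X i ω = p}

/-- `N` and `X` generate a Poisson point process of intensity `n ν`: `N` has the Poisson law of
parameter `n`, the `X i` are i.i.d. with law `ν`, and `N` is independent of the sequence `X`. -/
structure IsPoissonSample {Ω E : Type*} [MeasurableSpace Ω] [MeasurableSpace E]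
    (P : Measure Ω) (ν : Measure E) (n : ℕ) (N : Ω → ℕ) (X : ℕ → Ω → E) : Prop where
  measurable_count : Measurable N
  measurable_point : ∀ i, Measurable (X i)
  law_count : P.map N = poissonMeasure (n : NNReal)
  law_point : ∀ i, P.map (X i) = ν
  indep_points : iIndepFun X P
  indep_count : IndepFun N (fun ω i => X i ω) P

/-- The geometric graph on the vertex set `S`: distinct points at distance less than `r` are
joined by an edge. -/
def geometricGraph {E : Type*} [PseudoMetricSpace E] (S : Set E) (r : ℝ) : SimpleGraph S where
  Adj x y := x ≠ y ∧ dist (x : E) (y : E) < r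
  symm := ⟨fun _ _ h => ⟨h.1.symm, by rw [dist_comm]; exact h.2⟩⟩
  loopless := ⟨fun _ h => h.1 rfl⟩

/-- A graph is disconnected if two of its vertices are not joined by a path. In particular the
empty graph and a single vertex are not disconnected. -/
def Disconnected {V : Type*} (G : SimpleGraph V) : Prop := ¬ G.Preconnected

/-- `A n` holds with high probability: `P (A n) → 1`. -/
def WithHighProbability {Ω : Type*} [MeasurableSpace Ω] (P : Measure Ω) (A : ℕ → Set Ω) : Prop :=
  Tendsto (fun n => P (A n)) atTop (𝓝 1)

end RGG

namespace RGG

/-! Fix a unit vector `e`. Subexponential decay makes the profile `q (R • e)` long-tailed: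
asymptotically unchanged by bounded shifts of `R`. Bounded shifts of `R` are vanishing shifts of
`log R`, so for regularly varying functions this follows from the uniform convergence theorem
(`tendsto_sub_of_slowly_varying`). In the light-tailed case it applies to `L`, while `v < 1` and
monotonicity of `ψ'` force `ψ' → 0`, so that `ψ` too changes by `o(1)` under bounded shifts.

A long-tailed profile of an integrable density tends to zero, and eventually loses at most a factor
two per unit step. Hence for large `n` there is a far away `R` with `n * q (R • e)` in `[1/2, 1]`.
On `K` disjoint balls of radius 2 along the ray near `R • e`, the Poisson intensity is then bounded
above and below. Each ball therefore has probability at least `δ > 0`, with `δ` independent of `n`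
and `K`, of containing points within `1/2` of its centre and no others. For `r ≤ 1` such a cluster
is cut off from the rest of the sample. The `K` events are pairwise independent, so by Chebyshev two
of them occur with probability at least `1 - 4 / (K δ)`; then `K → ∞`. -/

/-! ### Regular variation and long tails -/

/-- The uniform convergence theorem for additively slowly varying functions, sequential form. -/
theorem tendsto_sub_of_slowly_varying {h : ℝ → ℝ} (hm : Measurable h)
    (hh : ∀ u, Tendsto (fun x => h (x + u) - h x) atTop (𝓝 0)) {x y : ℕ → ℝ}
    (hx : Tendsto x atTop atTop) (hy : Tendsto y atTop atTop)
    (hxy : ∀ᶠ n in atTop, |x n - y n| ≤ 1) :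
    Tendsto (fun n => h (x n) - h (y n)) atTop (𝓝 0) := by
  -- Pointwise convergence gives convergence in measure on `[0, 2]`. The threshold `1/2` is chosen
  -- so that two bad sets cannot cover a unit interval.
  have key : ∀ z : ℕ → ℝ, Tendsto z atTop atTop → ∀ ε : ℝ, 0 < ε → ∀ᶠ n in atTop,
      volume ({u | ε ≤ |h (z n + u) - h (z n)|} ∩ Set.Icc 0 2) < 2⁻¹ := by
    intro z hz ε hε
    have hmeas : ∀ n, Measurable (fun u => h (z n + u) - h (z n)) := fun n => by fun_prop
    have := tendstoInMeasure_of_tendsto_ae (μ := volume.restrict (Set.Icc (0 : ℝ) 2))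
      (f := fun n u => h (z n + u) - h (z n)) (g := fun _ => 0)
      (fun n => (hmeas n).aestronglyMeasurable)
      (ae_of_all _ fun u => (hh u).comp hz)
    have h2 := (tendstoInMeasure_iff_norm.1 this ε hε).eventually_lt_const
      (show (0 : ENNReal) < 2⁻¹ by simp)
    filter_upwards [h2] with n hn
    rw [Measure.restrict_apply] at hn
    · simpa using hn
    · exact measurableSet_le measurable_const ((hmeas n).sub measurable_const).norm
  rw [Metric.tendsto_atTop']
  intro ε hε
  have hev : ∀ᶠ n in atTop, |h (x n) - h (y n)| < ε := by
    filter_upwards [key x hx (ε / 2) (by positivity), key y hy (ε / 2) (by positivity), hxy]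
      with n h1 h2 h3
    set U := {u | ε / 2 ≤ |h (x n + u) - h (x n)|} ∩ Set.Icc 0 2
    set W := {u | ε / 2 ≤ |h (y n + u) - h (y n)|} ∩ Set.Icc 0 2
    -- The translated bad sets miss some `z` in this interval. Since `z` lies within 2 to the right
    -- of both `x n` and `y n`, `h z` is `ε / 2`-close to both `h (x n)` and `h (y n)`.
    have hlt : volume ((fun z => -x n + z) ⁻¹' U ∪ (fun z => -y n + z) ⁻¹' W)
        < volume (Set.Icc (max (x n) (y n)) (max (x n) (y n) + 1)) := by
      refine (measure_union_le _ _).trans_lt ?_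
      rw [measure_preimage_add, measure_preimage_add, Real.volume_Icc]
      simpa [ENNReal.inv_two_add_inv_two] using ENNReal.add_lt_add h1 h2
    obtain ⟨z, hz, hz'⟩ := Set.not_subset.1 fun hs => (measure_mono hs).not_gt hlt
    have h4 := abs_le.1 h3
    have ha := le_max_left (x n) (y n)
    have hb := le_max_right (x n) (y n)
    have hc : max (x n) (y n) ≤ x n + 1 := max_le (by linarith) (by linarith)
    have hd : max (x n) (y n) ≤ y n + 1 := max_le (by linarith) (by linarith)
    simp only [Set.mem_Icc] at hz
    simp only [Set.mem_union, Set.mem_preimage, not_or, U, W, Set.mem_inter_iff, not_and',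
      Set.mem_ofPred_eq, not_le, Set.mem_Icc] at hz'
    have e1 := hz'.1 ⟨by linarith, by linarith⟩
    have e2 := hz'.2 ⟨by linarith, by linarith⟩
    simp only [add_neg_cancel_left] at e1 e2
    rw [abs_lt] at *
    constructor <;> linarith
  obtain ⟨n₀, hn₀⟩ := eventually_atTop.1 hev
  exact ⟨n₀, fun n hn => by simpa [Real.dist_eq] using hn₀ n hn.le⟩

/-- `f` is asymptotically invariant under bounded translations (in logarithmic form). -/
def LongTailed (f : ℝ → ℝ) : Prop :=
  ∀ (S : ℝ) (a b : ℕ → ℝ), Tendsto a atTop atTop → Tendsto b atTop atTop →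
    (∀ n, |a n - b n| ≤ S) → Tendsto (fun n => Real.log (f (a n)) - Real.log (f (b n))) atTop (𝓝 0)

theorem tendsto_log_sub_log {S : ℝ} {a b : ℕ → ℝ} (ha : Tendsto a atTop atTop)
    (hb : Tendsto b atTop atTop) (hab : ∀ n, |a n - b n| ≤ S) :
    Tendsto (fun n => Real.log (a n) - Real.log (b n)) atTop (𝓝 0) := by
  have h1 : Tendsto (fun n => (a n - b n) / b n) atTop (𝓝 0) := by
    refine squeeze_zero_norm' ?_ (hb.const_div_atTop S)
    filter_upwards [hb.eventually_gt_atTop 0] with n hn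
    rw [norm_div, Real.norm_eq_abs, Real.norm_of_nonneg hn.le]
    gcongr
    exact hab n
  have h2 := (Real.continuousAt_log one_ne_zero).tendsto.comp
    (show Tendsto (fun n => (a n - b n) / b n + 1) atTop (𝓝 1) by simpa using h1.add_const 1)
  rw [Real.log_one] at h2
  refine h2.congr' ?_
  filter_upwards [ha.eventually_gt_atTop 0, hb.eventually_gt_atTop 0] with n hn hn'
  rw [Function.comp_apply, ← Real.log_div hn.ne' hn'.ne']
  congr 1
  field_simp
  ring

/-- In the variable `x = log R`, subtracting `α * x` from `log L` leaves an additively slowly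
varying function, and `log a - log b → 0` when `a - b` is bounded. Measurability is asked after
composing with `exp` because only positive arguments matter. -/
theorem RegularlyVarying.longTailed {L : ℝ → ℝ} {α : ℝ} (hL : RegularlyVarying L α)
    (hm : Measurable fun x => L (Real.exp x)) : LongTailed L := by
  intro S a b ha hb hab
  have hlog := tendsto_log_sub_log ha hb hab
  have hslow : ∀ u, Tendsto (fun x => (Real.log (L (Real.exp (x + u))) - α * (x + u)) -
      (Real.log (L (Real.exp x)) - α * x)) atTop (𝓝 0) := by
    intro u
    have h1 := (hL.2 (Real.exp u) (Real.exp_pos u)).comp Real.tendsto_exp_atTop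
    have h2 := ((Real.continuousAt_log (Real.rpow_pos_of_pos (Real.exp_pos u) α).ne').tendsto.comp
      h1).sub_const (α * u)
    rw [Real.log_rpow (Real.exp_pos u), Real.log_exp, sub_self] at h2
    refine h2.congr' ?_
    have hpos := Real.tendsto_exp_atTop.eventually hL.1
    filter_upwards [hpos, (tendsto_atTop_add_const_right _ u tendsto_id).eventually hpos]
      with x hx hx'
    simp only [id] at hx'
    simp only [Function.comp_apply]
    rw [← Real.exp_add, add_comm u, Real.log_div hx'.ne' hx.ne']
    ring
  have hmain := tendsto_sub_of_slowly_varying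
    (h := fun x => Real.log (L (Real.exp x)) - α * x)
    ((Real.measurable_log.comp hm).sub (measurable_const.mul measurable_id)) hslow
    (Real.tendsto_log_atTop.comp ha) (Real.tendsto_log_atTop.comp hb)
    (by
      filter_upwards [Metric.tendsto_nhds.1 hlog 1 one_pos] with n hn
      simpa [Real.dist_eq] using hn.le)
  have := hmain.add (hlog.const_mul α)
  rw [mul_zero, add_zero] at this
  refine this.congr' ?_
  filter_upwards [ha.eventually_gt_atTop 0, hb.eventually_gt_atTop 0] with n hn hn'
  simp only [Function.comp_apply, Real.exp_log hn, Real.exp_log hn']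
  ring

/-! ### Light tails: `ψ'` tends to zero -/

/-- A locally bounded function that contracts under doubling of the argument tends to zero. -/
theorem tendsto_zero_of_doubling {g : ℝ → ℝ} {c M R₀ : ℝ} (hR₀ : 0 < R₀) (hc : 0 ≤ c) (hc1 : c < 1)
    (hg : ∀ R, R₀ ≤ R → 0 ≤ g R) (hM : ∀ R, R₀ ≤ R → R ≤ 2 * R₀ → g R ≤ M)
    (hd : ∀ R, R₀ ≤ R → g (2 * R) ≤ c * g R) : Tendsto g atTop (𝓝 0) := by
  have hM0 : 0 ≤ M := (hg R₀ le_rfl).trans (hM R₀ le_rfl (by linarith))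
  -- `k` counts the contractions gained; `l` only makes the range of `R` finite, so that halving
  -- reaches `[R₀, 2 * R₀]` by induction.
  have bound : ∀ k l : ℕ, ∀ R, R₀ * 2 ^ k ≤ R → R ≤ R₀ * 2 ^ (k + l + 1) → g R ≤ M * c ^ k := by
    have b0 : ∀ l : ℕ, ∀ R, R₀ ≤ R → R ≤ R₀ * 2 ^ (l + 1) → g R ≤ M := by
      intro l
      induction l with
      | zero => intro R h1 h2; exact hM R h1 (by simpa [mul_comm] using h2)
      | succ l ih =>
        intro R h1 h2
        by_cases h : R ≤ 2 * R₀
        · exact hM R h1 h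
        · push Not at h
          have h3 := hd (R / 2) (by linarith)
          have h4 := ih (R / 2) (by linarith) (by rw [pow_succ] at h2; linarith)
          have h5 := hg (R / 2) (by linarith)
          rw [mul_div_cancel₀ R two_ne_zero] at h3
          nlinarith
    intro k
    induction k with
    | zero => intro l R h1 h2; simpa using b0 l R (by simpa using h1) (by simpa using h2)
    | succ k ih =>
      intro l R h1 h2
      have hp : (1 : ℝ) ≤ 2 ^ k := one_le_pow₀ (by norm_num)
      have e1 : R₀ * 2 ^ k ≤ R / 2 := by rw [pow_succ] at h1; linarith
      have h3 := hd (R / 2) (le_trans (by nlinarith) e1)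
      have h4 := ih l (R / 2) e1 (by
        rw [show k + 1 + l + 1 = (k + l + 1) + 1 by ring, pow_succ] at h2; linarith)
      rw [mul_div_cancel₀ R two_ne_zero] at h3
      calc g R ≤ c * g (R / 2) := h3
        _ ≤ c * (M * c ^ k) := by gcongr
        _ = M * c ^ (k + 1) := by ring
  rw [Metric.tendsto_atTop]
  intro ε hε
  obtain ⟨k, hk⟩ := ((tendsto_pow_atTop_nhds_zero_of_lt_one hc hc1).const_mul M
    |>.eventually_lt_const (u := ε) (by simpa using hε)).exists
  refine ⟨R₀ * 2 ^ k, fun R hR => ?_⟩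
  have hp : (1 : ℝ) ≤ 2 ^ k := one_le_pow₀ (by norm_num)
  have hRR : R₀ ≤ R := le_trans (by nlinarith) hR
  obtain ⟨l, hl⟩ := pow_unbounded_of_one_lt (R / R₀) (one_lt_two (α := ℝ))
  rw [div_lt_iff₀ hR₀] at hl
  rw [Real.dist_eq, sub_zero, abs_of_nonneg (hg R hRR)]
  refine (bound k l R hR ?_).trans_lt hk
  have : (2 : ℝ) ^ l ≤ 2 ^ (k + l + 1) := pow_le_pow_right₀ (by norm_num) (by omega)
  nlinarith

theorem IsVonMises.differentiableAt {ψ : ℝ → ℝ} (h : IsVonMises ψ) {z : ℝ} (hz : 0 < z) :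
    DifferentiableAt ℝ ψ z :=
  (h.contDiffOn.differentiableOn (by norm_num)).differentiableAt (Ici_mem_nhds hz)

/-- With `2 ^ v < c < 2`, doubling `R` eventually multiplies `ψ R / R` by at most `c / 2 < 1`. -/
theorem RegularlyVarying.tendsto_div_id_zero {ψ : ℝ → ℝ} {v : ℝ} (h : IsVonMises ψ) (hv : v < 1)
    (hr : RegularlyVarying ψ v) : Tendsto (fun R => ψ R / R) atTop (𝓝 0) := by
  have h2 : (2 : ℝ) ^ v < 2 := by
    simpa using Real.rpow_lt_rpow_of_exponent_lt one_lt_two hv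
  obtain ⟨c, hc, hc2⟩ := exists_between h2
  have hc0 : 0 < c := (Real.rpow_pos_of_pos two_pos v).trans hc
  obtain ⟨R₁, hR₁⟩ := eventually_atTop.1
    (((hr.2 2 two_pos).eventually_lt_const hc).and (hr.1.and (eventually_ge_atTop 1)))
  have hR0 : 0 < R₁ := zero_lt_one.trans_le (hR₁ R₁ le_rfl).2.2
  obtain ⟨M, hM⟩ := (isCompact_Icc (a := R₁) (b := 2 * R₁)).bddAbove_image
    (f := fun R => ψ R / R) (fun z hz => by
      have hz0 : 0 < z := hR0.trans_le hz.1
      exact ((h.differentiableAt hz0).continuousAt.div continuousAt_id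
        hz0.ne').continuousWithinAt)
  refine tendsto_zero_of_doubling (c := c / 2) (M := M) hR0 (by positivity) (by linarith)
    (fun R hR => ?_) (fun R h1 h2 => hM ⟨R, ⟨h1, h2⟩, rfl⟩) (fun R hR => ?_)
  · exact div_nonneg (hR₁ R hR).2.1.le (hR0.trans_le hR).le
  · have h3 := (hR₁ R hR).1
    rw [div_lt_iff₀ (hR₁ R hR).2.1] at h3
    have hR' := hR0.trans_le hR
    rw [div_le_iff₀ (by positivity)]
    calc ψ (2 * R) ≤ c * ψ R := h3.le
      _ = c / 2 * (ψ R / R) * (2 * R) := by field_simp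

/-- The mean value theorem on a dyadic interval bounds `ψ'` at an interior point by a multiple of `ψ
R / R` at the right endpoint. Monotonicity transfers the bound to the left endpoint if `ψ'`
increases, to the right one if it decreases. -/
theorem IsVonMises.tendsto_deriv_zero {ψ : ℝ → ℝ} {v : ℝ} (h : IsVonMises ψ)
    (hmono : EventuallyMonotone (deriv ψ)) (hv : v < 1) (hr : RegularlyVarying ψ v) :
    Tendsto (deriv ψ) atTop (𝓝 0) := by
  have h0 := hr.tendsto_div_id_zero h hv
  have mvt : ∀ R, 0 < R → ∃ c ∈ Set.Ioo R (2 * R), deriv ψ c = (ψ (2 * R) - ψ R) / R := by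
    intro R hR
    obtain ⟨c, hc, hc'⟩ := exists_deriv_eq_slope ψ (show R < 2 * R by linarith)
      (fun z hz => (h.differentiableAt (hR.trans_le hz.1)).continuousAt.continuousWithinAt)
      (fun z hz => (h.differentiableAt (hR.trans hz.1)).differentiableWithinAt)
    exact ⟨c, hc, by rw [hc']; ring⟩
  obtain ⟨z₀, hz | hz⟩ := hmono
  · have ht : Tendsto (fun R => 2 * (ψ (2 * R) / (2 * R))) atTop (𝓝 0) := by
      simpa using (h0.comp (tendsto_id.const_mul_atTop (two_pos (α := ℝ)))).const_mul 2
    refine squeeze_zero' (h.deriv_pos.mono fun _ => le_of_lt) ?_ ht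
    filter_upwards [eventually_ge_atTop z₀, eventually_gt_atTop 0] with R h1 h2
    obtain ⟨c, hc, hc'⟩ := mvt R h2
    refine (hz h1 (h1.trans hc.1.le) hc.1.le).trans ?_
    rw [hc', show 2 * (ψ (2 * R) / (2 * R)) = ψ (2 * R) / R by field_simp]
    gcongr
    linarith [h.nonneg R h2.le]
  · have ht : Tendsto (fun R => 2 * (ψ R / R)) atTop (𝓝 0) := by simpa using h0.const_mul 2
    refine squeeze_zero' (h.deriv_pos.mono fun _ => le_of_lt) ?_ ht
    filter_upwards [eventually_ge_atTop (2 * z₀), eventually_gt_atTop 0] with R h1 h2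
    obtain ⟨c, hc, hc'⟩ := mvt (R / 2) (by linarith)
    have e : 2 * (R / 2) = R := by ring
    rw [e] at hc hc'
    refine (hz (Set.mem_Ici.2 (by linarith [hc.1])) (Set.mem_Ici.2 (by linarith [hc.1, hc.2]))
      hc.2.le).trans ?_
    rw [hc', show 2 * (ψ R / R) = ψ R / (R / 2) by field_simp]
    gcongr
    linarith [h.nonneg (R / 2) (by linarith)]

theorem tendsto_sub_of_tendsto_deriv_zero {ψ : ℝ → ℝ} (hd : ∀ z, 0 < z → DifferentiableAt ℝ ψ z)
    (h0 : Tendsto (deriv ψ) atTop (𝓝 0)) {S : ℝ} {a b : ℕ → ℝ} (ha : Tendsto a atTop atTop)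
    (hb : Tendsto b atTop atTop) (hab : ∀ n, |a n - b n| ≤ S) :
    Tendsto (fun n => ψ (a n) - ψ (b n)) atTop (𝓝 0) := by
  have hS : 0 ≤ S := (abs_nonneg _).trans (hab 0)
  rw [Metric.tendsto_nhds]
  intro ε hε
  obtain ⟨R, hR⟩ := eventually_atTop.1 (Metric.tendsto_nhds.1 h0 (ε / (S + 1)) (by positivity))
  filter_upwards [ha.eventually_ge_atTop (max R 1), hb.eventually_ge_atTop (max R 1)] with n h1 h2
  have := (convex_Ici (max R 1)).norm_image_sub_le_of_norm_deriv_le (f := ψ) (C := ε / (S + 1))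
    (fun z hz => hd z (zero_lt_one.trans_le ((le_max_right R 1).trans hz)))
    (fun z hz => by simpa [Real.dist_eq] using (hR z ((le_max_left R 1).trans hz)).le) h2 h1
  rw [Real.dist_eq, sub_zero]
  refine this.trans_lt ?_
  calc ε / (S + 1) * ‖a n - b n‖ ≤ ε / (S + 1) * S := by gcongr; exact hab n
    _ < ε := by rw [div_mul_eq_mul_div, div_lt_iff₀ (by positivity)]; nlinarith

/-- The profile of `q` along the ray through the unit vector `e` is long-tailed. -/
theorem HasSubexponentialDecay.longTailed {d : ℕ} {q : EuclideanSpace ℝ (Fin d) → ℝ}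
    (hq : IsRadialDensity q) (h : HasSubexponentialDecay q) {e : EuclideanSpace ℝ (Fin d)}
    (he : ‖e‖ = 1) : LongTailed fun R => q (R • e) := by
  have hnorm : ∀ R : ℝ, 0 ≤ R → ‖R • e‖ = R := fun R hR => by
    rw [norm_smul, he, mul_one, Real.norm_of_nonneg hR]
  have hqm := hq.measurable
  rcases h with ⟨f, α, hf, -, hrv⟩ | ⟨ψ, v, ⟨hψ, hmono, L, α, hL, hqL⟩, -, hv1, hrv⟩
  · have hfq : ∀ R : ℝ, 0 ≤ R → f R = q (R • e) := fun R hR => by rw [← hf, hnorm R hR]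
    intro S a b ha hb hab
    refine (hrv.longTailed ?_ S a b ha hb hab).congr' ?_
    · simp_rw [fun x => hfq _ (Real.exp_pos x).le]
      fun_prop
    · filter_upwards [ha.eventually_ge_atTop 0, hb.eventually_ge_atTop 0] with n h1 h2
      rw [hfq _ h1, hfq _ h2]
  -- Solving for `L` supplies its measurability on the half-line from that of `q` and `ψ`.
  · have hLq : ∀ R : ℝ, 0 ≤ R → L R = q (R • e) * Real.exp (ψ R) := fun R hR => by
      rw [hqL, hnorm R hR, mul_assoc, ← Real.exp_add, neg_add_cancel, Real.exp_zero, mul_one]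
    intro S a b ha hb hab
    have hψc : Continuous fun x => ψ (Real.exp x) :=
      hψ.contDiffOn.continuousOn.comp_continuous Real.continuous_exp fun x => (Real.exp_pos x).le
    have h1 := hL.longTailed (by
      simp_rw [fun x => hLq _ (Real.exp_pos x).le]
      exact (hqm.comp (Real.measurable_exp.smul_const e)).mul
        (Real.measurable_exp.comp hψc.measurable)) S a b ha hb hab
    have h2 := tendsto_sub_of_tendsto_deriv_zero (fun z hz => hψ.differentiableAt hz)
      (hψ.tendsto_deriv_zero hmono hv1 hrv) ha hb hab
    have h3 := h1.sub h2
    rw [sub_zero] at h3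
    refine h3.congr' ?_
    filter_upwards [ha.eventually_ge_atTop 0, hb.eventually_ge_atTop 0] with n h1 h2
    rw [hLq _ h1, hLq _ h2, Real.log_mul (hq.pos _).ne' (Real.exp_pos _).ne',
      Real.log_mul (hq.pos _).ne' (Real.exp_pos _).ne', Real.log_exp, Real.log_exp]
    ring

/-- A positive long-tailed function is constant up to a factor two on far away bounded windows. -/
theorem LongTailed.eventually_ratio {f : ℝ → ℝ} (h : LongTailed f) (hf : ∀ R, 0 < f R) (S : ℝ) :
    ∀ᶠ R in atTop, ∀ a, |a - R| ≤ S → f R / 2 ≤ f a ∧ f a ≤ 2 * f R := by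
  -- Failure at arbitrarily large `R` yields two sequences at bounded distance that contradict
  -- `LongTailed`, with tolerance `log 2`.
  by_contra hcon
  have hfr := fun n : ℕ => frequently_atTop.1 (not_eventually.1 hcon) (n : ℝ)
  choose R hR hR' using hfr
  push Not at hR'
  choose a ha ha' using hR'
  have hRt : Tendsto R atTop atTop := tendsto_atTop_mono hR tendsto_natCast_atTop_atTop
  have hat : Tendsto a atTop atTop := by
    refine tendsto_atTop_mono (fun n => ?_) (tendsto_atTop_add_const_right _ (-S) hRt)
    have := abs_le.1 (ha n)
    linarith
  obtain ⟨n, hn⟩ := (Metric.tendsto_nhds.1 (h S a R hat hRt ha) (Real.log 2)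
    (Real.log_pos one_lt_two)).exists
  rw [Real.dist_eq, sub_zero, abs_lt] at hn
  have e1 : f (R n) / 2 ≤ f (a n) := by
    rw [← Real.log_le_log_iff (half_pos (hf _)) (hf _), Real.log_div (hf _).ne' two_ne_zero]
    linarith
  have e2 : f (a n) ≤ 2 * f (R n) := by
    rw [← Real.log_le_log_iff (hf _) (mul_pos two_pos (hf _)), Real.log_mul two_ne_zero (hf _).ne']
    linarith
  exact absurd e2 (not_le.2 (ha' n e1))

/-! ### Second moment bound for pairwise independent events -/

section Chebyshev

variable {Ω : Type*} [MeasurableSpace Ω] {P : Measure Ω} [IsProbabilityMeasure P]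

theorem covariance_indicator_one {A B : Set Ω} (hA : MeasurableSet A) (hB : MeasurableSet B) :
    covariance (A.indicator (1 : Ω → ℝ)) (B.indicator 1) P
      = P.real (A ∩ B) - P.real A * P.real B := by
  have hm : ∀ C : Set Ω, MeasurableSet C → MemLp (C.indicator (1 : Ω → ℝ)) 2 P := fun C hC =>
    (memLp_const (1 : ℝ)).indicator hC
  rw [covariance_eq_sub (hm A hA) (hm B hB), ← Set.inter_indicator_one,
    integral_indicator_one (hA.inter hB), integral_indicator_one hA, integral_indicator_one hB]

/-- Among `K` pairwise independent events of probability at least `δ`, at least two occur, except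
with probability at most `4 / (K δ)`. -/
theorem measureReal_two_occur {K : ℕ} {E : Fin K → Set Ω} (hE : ∀ i, MeasurableSet (E i))
    (hind : ∀ i j, i ≠ j → P.real (E i ∩ E j) = P.real (E i) * P.real (E j)) {δ : ℝ}
    (hδ : ∀ i, δ ≤ P.real (E i)) (hK : 2 ≤ K * δ) :
    1 - 4 / (K * δ) ≤ P.real (⋃ i, ⋃ j, ⋃ _ : i ≠ j, E i ∩ E j) := by
  set Y : Fin K → Ω → ℝ := fun i => (E i).indicator 1
  set s : ℝ := ∑ i, P.real (E i)
  have hY : ∀ i, MemLp (Y i) 2 P := fun i => (memLp_const (1 : ℝ)).indicator (hE i)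
  have hs : K * δ ≤ s := by
    calc (K : ℝ) * δ = ∑ _i : Fin K, δ := by simp
      _ ≤ s := Finset.sum_le_sum fun i _ => hδ i
  have hmean : ∫ ω, (∑ i, Y i) ω ∂P = s := by
    simp_rw [Finset.sum_apply]
    rw [integral_finsetSum _ fun i _ => (hY i).integrable (by norm_num)]
    exact Finset.sum_congr rfl fun i _ => integral_indicator_one (hE i)
  -- Off-diagonal covariances vanish, and a diagonal one is `p - p ^ 2 ≤ p`.
  have hvar : variance (∑ i, Y i) P ≤ s := by
    rw [variance_sum hY]
    refine Finset.sum_le_sum fun i _ => ?_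
    rw [Finset.sum_eq_single i]
    · rw [covariance_indicator_one (hE i) (hE i), Set.inter_self]
      nlinarith [sq_nonneg (P.real (E i))]
    · intro j _ hj
      rw [covariance_indicator_one (hE i) (hE j), hind i j hj.symm, sub_self]
    · simp
  have hcheb := meas_ge_le_variance_div_sq (μ := P) (X := ∑ i, Y i)
    (memLp_finsetSum' _ fun i _ => hY i) (c := s / 2) (by linarith)
  rw [hmean] at hcheb
  have hbad : P.real (⋃ i, ⋃ j, ⋃ _ : i ≠ j, E i ∩ E j)ᶜ ≤ 4 / (K * δ) := by
    -- If at most one event occurs, the count is at most `1 ≤ s / 2`, because `s ≥ K * δ ≥ 2`.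
    have hsub : (⋃ i, ⋃ j, ⋃ _ : i ≠ j, E i ∩ E j)ᶜ ⊆ {ω | s / 2 ≤ |(∑ i, Y i) ω - s|} := by
      intro ω hω
      simp only [ne_eq, Set.mem_compl_iff, Set.mem_iUnion, Set.mem_inter_iff, not_exists,
        not_and] at hω
      have hle : (∑ i, Y i) ω ≤ 1 := by
        rw [Finset.sum_apply]
        by_cases h : ∃ i, ω ∈ E i
        · obtain ⟨i, hi⟩ := h
          rw [Finset.sum_eq_single i]
          · exact Set.indicator_le_self' (by simp) _
          · intro j _ hj
            exact Set.indicator_of_notMem (hω i j (Ne.symm hj) hi) _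
          · simp
        · push Not at h
          rw [Finset.sum_eq_zero fun i _ => Set.indicator_of_notMem (h i) _]
          exact zero_le_one
      rw [Set.mem_ofPred_eq, abs_of_nonpos (by linarith)]
      linarith
    refine (ENNReal.toReal_mono ENNReal.ofReal_ne_top ((measure_mono hsub).trans hcheb)).trans ?_
    rw [ENNReal.toReal_ofReal (div_nonneg (variance_nonneg _ _) (sq_nonneg _))]
    calc variance (∑ i, Y i) P / (s / 2) ^ 2 ≤ s / (s / 2) ^ 2 := by gcongr
      _ = 4 / s := by field_simp; norm_num
      _ ≤ 4 / (K * δ) := by gcongr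
  rw [probReal_compl_eq_one_sub (by measurability)] at hbad
  linarith

end Chebyshev

/-! ### Void probabilities and independence for the Poisson sample -/

section Poisson

variable {Ω E : Type*} {N : Ω → ℕ} {X : ℕ → Ω → E}

/-- The event that no sample point lies in `C`. -/
def void (N : Ω → ℕ) (X : ℕ → Ω → E) (C : Set E) : Set Ω :=
  {ω | ∀ i, i < N ω → X i ω ∉ C}

theorem void_inter (C D : Set E) : void N X C ∩ void N X D = void N X (C ∪ D) := by
  ext ω
  simp only [void, Set.mem_inter_iff, Set.mem_ofPred_eq, Set.mem_union, not_or]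
  exact ⟨fun h i hi => ⟨h.1 i hi, h.2 i hi⟩, fun h => ⟨fun i hi => (h i hi).1, fun i hi => (h i hi).2⟩⟩

/-- The event that some sample point lies in `A` but none in `B`. -/
def hit (N : Ω → ℕ) (X : ℕ → Ω → E) (A B : Set E) : Set Ω := void N X B \ void N X (A ∪ B)

theorem void_union_subset (A B : Set E) : void N X (A ∪ B) ⊆ void N X B :=
  fun _ hω i hi hB => hω i hi (Or.inr hB)

variable [MeasurableSpace Ω] [MeasurableSpace E] {P : Measure Ω}
  {ν : Measure E} {n : ℕ}

theorem measureReal_forall_lt_notMem [IsProbabilityMeasure P] (h : IsPoissonSample P ν n N X) {C : Set E}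
    (hC : MeasurableSet C) (k : ℕ) :
    P.real {ω | ∀ i, i < k → X i ω ∉ C} = (1 - ν.real C) ^ k := by
  have h1 := h.indep_points.measure_inter_preimage_eq_mul (Finset.range k)
    (sets := fun _ => Cᶜ) fun i _ => hC.compl
  have h2 : {ω | ∀ i, i < k → X i ω ∉ C} = ⋂ i ∈ Finset.range k, X i ⁻¹' Cᶜ := by
    ext ω; simp
  rw [h2, measureReal_def, h1, ENNReal.toReal_prod]
  have h3 : ∀ i, (P (X i ⁻¹' Cᶜ)).toReal = 1 - ν.real C := fun i => by
    rw [Set.preimage_compl, ← measureReal_def,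
      probReal_compl_eq_one_sub (h.measurable_point i hC), ← h.law_point i,
      map_measureReal_apply (h.measurable_point i) hC]
  rw [Finset.prod_congr rfl fun i _ => h3 i, Finset.prod_const, Finset.card_range]

theorem measurableSet_void (h : IsPoissonSample P ν n N X) {C : Set E} (hC : MeasurableSet C) :
    MeasurableSet (void N X C) := by
  simp only [void, Set.ofPred_forall]
  refine MeasurableSet.iInter fun i => ?_
  have : {ω | i < N ω → X i ω ∉ C} = (N ⁻¹' Set.Ioi i)ᶜ ∪ (X i ⁻¹' C)ᶜ := by
    ext ω; simp [imp_iff_not_or]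
  rw [this]
  exact (h.measurable_count measurableSet_Ioi).compl.union (h.measurable_point i hC).compl

/-- Void probabilities of the Poisson sample. -/
theorem measureReal_void [IsProbabilityMeasure P] (h : IsPoissonSample P ν n N X) {C : Set E} (hC : MeasurableSet C) :
    P.real (void N X C) = Real.exp (-(n * ν.real C)) := by
  have hsplit : void N X C = ⋃ k, N ⁻¹' {k} ∩ {ω | ∀ i, i < k → X i ω ∉ C} := by
    ext ω; simp [void]
  have hmeas : ∀ k, MeasurableSet (N ⁻¹' {k} ∩ {ω | ∀ i, i < k → X i ω ∉ C}) := fun k => by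
    refine (h.measurable_count (measurableSet_singleton k)).inter ?_
    simp only [Set.ofPred_forall]
    exact MeasurableSet.iInter fun i => MeasurableSet.iInter fun _ => (h.measurable_point i hC).compl
  have hterm : ∀ k, P.real (N ⁻¹' {k} ∩ {ω | ∀ i, i < k → X i ω ∉ C})
      = Real.exp (-n) * ((n * (1 - ν.real C)) ^ k / k.factorial) := fun k => by
    have hT : MeasurableSet {x : ℕ → E | ∀ i, i < k → x i ∉ C} := by
      simp only [Set.ofPred_forall]
      exact MeasurableSet.iInter fun i => MeasurableSet.iInter fun _ =>
        (measurable_pi_apply i hC).compl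
    have h1 := h.indep_count.measure_inter_preimage_eq_mul {k} {x : ℕ → E | ∀ i, i < k → x i ∉ C}
      (measurableSet_singleton k) hT
    have h2 : P.real (N ⁻¹' {k}) = Real.exp (-n) * n ^ k / k.factorial := by
      rw [← map_measureReal_apply h.measurable_count (measurableSet_singleton k), h.law_count,
        poissonMeasure_real_singleton]
      simp
    rw [measureReal_def]
    refine (congrArg ENNReal.toReal h1).trans ?_
    rw [ENNReal.toReal_mul, ← measureReal_def, h2]
    have h3 := measureReal_forall_lt_notMem h hC k
    rw [measureReal_def] at h3
    refine (congrArg _ h3).trans ?_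
    rw [mul_pow]
    ring
  have hdisj : Pairwise (Function.onFun Disjoint
      fun k => N ⁻¹' {k} ∩ {ω | ∀ i, i < k → X i ω ∉ C}) := fun i j hij =>
    Set.disjoint_left.2 fun ω h1 h2 => hij (h1.1.symm.trans h2.1)
  rw [hsplit, measureReal_def, measure_iUnion hdisj hmeas,
    ENNReal.tsum_toReal_eq fun k => measure_ne_top _ _]
  simp_rw [← measureReal_def, hterm]
  rw [tsum_mul_left, (NormedSpace.expSeries_div_hasSum_exp _).tsum_eq, ← Real.exp_eq_exp_ℝ,
    ← Real.exp_add]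
  congr 1
  ring

theorem measurableSet_hit (h : IsPoissonSample P ν n N X) {A B : Set E} (hA : MeasurableSet A)
    (hB : MeasurableSet B) : MeasurableSet (hit N X A B) :=
  (measurableSet_void h hB).diff (measurableSet_void h (hA.union hB))

theorem measureReal_hit [IsProbabilityMeasure P]
    [IsProbabilityMeasure ν] (h : IsPoissonSample P ν n N X) {A B : Set E}
    (hA : MeasurableSet A) (hB : MeasurableSet B) (hAB : Disjoint A B) :
    P.real (hit N X A B) = Real.exp (-(n * ν.real B)) * (1 - Real.exp (-(n * ν.real A))) := by
  rw [hit, measureReal_sdiff (void_union_subset A B) (measurableSet_void h (hA.union hB)),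
    measureReal_void h hB, measureReal_void h (hA.union hB), measureReal_union hAB hB, mul_add,
    neg_add, Real.exp_add]
  ring

/-- Void probabilities are exponential in the measure, hence multiplicative over disjoint sets. Each
hit is a difference of nested void events, so inclusion-exclusion passes the product rule on to
hits. -/
theorem measureReal_hit_inter [IsProbabilityMeasure P]
    [IsProbabilityMeasure ν] (h : IsPoissonSample P ν n N X)
    {A B A' B' : Set E} (hA : MeasurableSet A) (hB : MeasurableSet B) (hA' : MeasurableSet A')
    (hB' : MeasurableSet B') (hd : Disjoint (A ∪ B) (A' ∪ B')) :
    P.real (hit N X A B ∩ hit N X A' B') = P.real (hit N X A B) * P.real (hit N X A' B') := by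
  have hmul : ∀ {C D : Set E}, MeasurableSet C → MeasurableSet D → Disjoint C D →
      P.real (void N X C ∩ void N X D) = P.real (void N X C) * P.real (void N X D) := by
    intro C D hC hD hCD
    rw [void_inter, measureReal_void h hC, measureReal_void h hD, measureReal_void h (hC.union hD),
      measureReal_union hCD hD, mul_add, neg_add, Real.exp_add]
  have hV := measurableSet_void h hB
  have hV' := measurableSet_void h hB'
  have hU := measurableSet_void h (hA.union hB)
  have hU' := measurableSet_void h (hA'.union hB')
  have hs := void_union_subset (N := N) (X := X) A B
  have hs' := void_union_subset (N := N) (X := X) A' B'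
  have e1 : hit N X A B ∩ hit N X A' B' = (void N X B ∩ void N X B') \
      (void N X (A ∪ B) ∩ void N X B' ∪ void N X B ∩ void N X (A' ∪ B')) := by
    ext ω
    simp only [hit, Set.mem_inter_iff, Set.mem_sdiff, Set.mem_union]
    tauto
  have e2 : (void N X (A ∪ B) ∩ void N X B') ∩ (void N X B ∩ void N X (A' ∪ B'))
      = void N X (A ∪ B) ∩ void N X (A' ∪ B') := by
    ext ω
    have := @hs ω
    have := @hs' ω
    simp only [Set.mem_inter_iff]
    tauto
  have e3 := measureReal_union_add_inter (μ := P)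
    (s := void N X (A ∪ B) ∩ void N X B') (hV.inter hU')
  rw [e2, hmul (hA.union hB) (hA'.union hB') hd,
    hmul (hA.union hB) hB' (hd.mono_right Set.subset_union_right),
    hmul hB (hA'.union hB') (hd.mono_left Set.subset_union_right)] at e3
  rw [e1, measureReal_sdiff (Set.union_subset (Set.inter_subset_inter_left _ hs)
      (Set.inter_subset_inter_right _ hs')) ((hU.inter hV').union (hV.inter hU')),
    hmul hB hB' (hd.mono Set.subset_union_right Set.subset_union_right), hit, hit,
    measureReal_sdiff hs hU, measureReal_sdiff hs' hU']
  linear_combination -e3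

end Poisson

/-! ### Isolated clusters -/

section Graph

/-- If the sample hits two balls of radius `1 / 2` surrounded by empty annuli, then the geometric
graph is disconnected. -/
theorem disconnected_of_hit {Ω E : Type*} [PseudoMetricSpace E] {N : Ω → ℕ} {X : ℕ → Ω → E} {ω : Ω}
    {r : ℝ} (hr : r ≤ 1) {c c' : E}
    (hd : Disjoint (Metric.ball c 2) (Metric.ball c' 2))
    (h : ω ∈ hit N X (Metric.ball c (1 / 2)) (Metric.ball c 2 \ Metric.ball c (1 / 2)))
    (h' : ω ∈ hit N X (Metric.ball c' (1 / 2)) (Metric.ball c' 2 \ Metric.ball c' (1 / 2))) :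
    Disconnected (geometricGraph (pointSet N X ω) r) := by
  have exists_mem : ∀ {A B : Set E}, ω ∈ hit N X A B → ∃ i, i < N ω ∧ X i ω ∈ A := by
    rintro A B ⟨h1, h2⟩
    simp only [void, Set.mem_ofPred_eq, not_forall, not_not] at h1 h2
    obtain ⟨i, hi, hA | hB⟩ := h2
    · exact ⟨i, hi, hA⟩
    · exact absurd hB (h1 i hi)
  obtain ⟨i, hi, hiA⟩ := exists_mem h
  obtain ⟨j, hj, hjA⟩ := exists_mem h'
  intro hconn
  -- An edge from the inner ball ends within `1/2 + 1 < 2` of `c`; as the annulus is empty, it ends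
  -- in the inner ball again.
  have hstep : ∀ u v : pointSet N X ω, (geometricGraph (pointSet N X ω) r).Adj u v →
      (u : E) ∈ Metric.ball c (1 / 2) → (v : E) ∈ Metric.ball c (1 / 2) := by
    rintro ⟨u, hu⟩ ⟨v, k, hk, rfl⟩ ⟨-, huv⟩ huA
    by_contra hv
    refine h.1 k hk ⟨?_, hv⟩
    simp only [Metric.mem_ball] at huv huA ⊢
    have := dist_triangle_left (X k ω) c u
    linarith
  have hreach : ∀ u v : pointSet N X ω, (geometricGraph (pointSet N X ω) r).Walk u v →
      (u : E) ∈ Metric.ball c (1 / 2) → (v : E) ∈ Metric.ball c (1 / 2) := by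
    intro u v p
    induction p with
    | nil => exact id
    | cons hadj _ ih => exact fun hu => ih (hstep _ _ hadj hu)
  obtain ⟨p⟩ := hconn ⟨X i ω, i, hi, rfl⟩ ⟨X j ω, j, hj, rfl⟩
  exact Set.disjoint_left.1 hd
    (Metric.ball_subset_ball (by norm_num) (hreach _ _ p hiA))
    (Metric.ball_subset_ball (by norm_num) hjA)

end Graph

/-! ### Mass of balls and the choice of scale -/

section Density

variable {d : ℕ} {q : EuclideanSpace ℝ (Fin d) → ℝ}

theorem IsRadialDensity.isProbabilityMeasure (hq : IsRadialDensity q) :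
    IsProbabilityMeasure (densityMeasure q) :=
  ⟨by rw [densityMeasure, withDensity_apply _ MeasurableSet.univ, Measure.restrict_univ,
    hq.lintegral_eq_one]⟩

theorem IsRadialDensity.apply_norm_smul (hq : IsRadialDensity q) {e : EuclideanSpace ℝ (Fin d)}
    (he : ‖e‖ = 1) (y : EuclideanSpace ℝ (Fin d)) : q (‖y‖ • e) = q y :=
  hq.radial _ _ (by rw [norm_smul, he, mul_one, norm_norm])

theorem densityMeasure_real_le {C : Set (EuclideanSpace ℝ (Fin d))} (hC : MeasurableSet C)
    (hfin : volume C ≠ ⊤) {M : ℝ} (hM : 0 ≤ M) (h : ∀ y ∈ C, q y ≤ M) :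
    (densityMeasure q).real C ≤ M * volume.real C := by
  have h1 : densityMeasure q C ≤ ENNReal.ofReal M * volume C := by
    rw [densityMeasure, withDensity_apply _ hC, ← setLIntegral_const]
    exact setLIntegral_mono' hC fun y hy => ENNReal.ofReal_le_ofReal (h y hy)
  refine (ENNReal.toReal_mono (ENNReal.mul_ne_top ENNReal.ofReal_ne_top hfin) h1).trans_eq ?_
  rw [ENNReal.toReal_mul, ENNReal.toReal_ofReal hM, measureReal_def]

theorem IsRadialDensity.le_densityMeasure_real (hq : IsRadialDensity q)
    {C : Set (EuclideanSpace ℝ (Fin d))} (hC : MeasurableSet C) {M : ℝ} (hM : 0 ≤ M)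
    (h : ∀ y ∈ C, M ≤ q y) : M * volume.real C ≤ (densityMeasure q).real C := by
  have := hq.isProbabilityMeasure
  have h1 : ENNReal.ofReal M * volume C ≤ densityMeasure q C := by
    rw [densityMeasure, withDensity_apply _ hC, ← setLIntegral_const]
    exact setLIntegral_mono' hC fun y hy => ENNReal.ofReal_le_ofReal (h y hy)
  refine Eq.trans_le ?_ (ENNReal.toReal_mono (measure_ne_top _ C) h1)
  rw [ENNReal.toReal_mul, ENNReal.toReal_ofReal hM, measureReal_def]

theorem abs_norm_sub_le_of_mem_ball {E : Type*} [NormedAddCommGroup E] [NormedSpace ℝ E] {e : E}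
    (he : ‖e‖ = 1) {R r : ℝ} (hR : 0 ≤ R) {y : E} (hy : y ∈ Metric.ball (R • e) r) :
    |‖y‖ - R| ≤ r := by
  have h1 := abs_norm_sub_norm_le y (R • e)
  rw [norm_smul, he, mul_one, Real.norm_of_nonneg hR] at h1
  rw [mem_ball_iff_norm] at hy
  exact h1.trans hy.le

theorem volume_real_ball_center (c : EuclideanSpace ℝ (Fin d)) (r : ℝ) :
    volume.real (Metric.ball c r) = volume.real (Metric.ball (0 : EuclideanSpace ℝ (Fin d)) r) := by
  rw [measureReal_def, Measure.addHaar_ball_center, measureReal_def]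

theorem volume_real_ball_pos {r : ℝ} (hr : 0 < r) :
    0 < volume.real (Metric.ball (0 : EuclideanSpace ℝ (Fin d)) r) :=
  ENNReal.toReal_pos (Metric.measure_ball_pos _ _ hr).ne' measure_ball_lt_top.ne

theorem tendsto_measure_le_norm_zero {E : Type*} [NormedAddCommGroup E] [MeasurableSpace E]
    [BorelSpace E] (ν : Measure E) [IsFiniteMeasure ν] (a : ℝ) :
    Tendsto (fun m : ℕ => ν.real {y | (m : ℝ) - a ≤ ‖y‖}) atTop (𝓝 0) := by
  have hempty : ⋂ m : ℕ, {y : E | (m : ℝ) - a ≤ ‖y‖} = ∅ := by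
    refine Set.eq_empty_of_forall_notMem fun y hy => ?_
    obtain ⟨m, hm⟩ := exists_nat_gt (‖y‖ + a)
    have := Set.mem_iInter.1 hy m
    simp only [Set.mem_ofPred_eq] at this
    linarith
  have h := tendsto_measure_iInter_atTop (μ := ν) (s := fun m : ℕ => {y : E | (m : ℝ) - a ≤ ‖y‖})
    (fun m => (measurableSet_le measurable_const measurable_norm).nullMeasurableSet)
    (fun m k hmk y (hy : (k : ℝ) - a ≤ ‖y‖) =>
      (sub_le_sub_right (Nat.cast_le.2 hmk) a).trans hy) ⟨0, measure_ne_top _ _⟩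
  rw [hempty, measure_empty] at h
  exact (ENNReal.tendsto_toReal ENNReal.zero_ne_top).comp h

/-- The unit ball about `m • e` carries mass at least a constant times `q (m • e)`, yet lies where
`‖y‖ ≥ m - 1`, a region of vanishing mass. -/
theorem IsRadialDensity.tendsto_zero (hq : IsRadialDensity q) {e : EuclideanSpace ℝ (Fin d)}
    (he : ‖e‖ = 1) (hlong : LongTailed fun R => q (R • e)) :
    Tendsto (fun m : ℕ => q ((m : ℝ) • e)) atTop (𝓝 0) := by
  have := hq.isProbabilityMeasure
  set V := volume.real (Metric.ball (0 : EuclideanSpace ℝ (Fin d)) 1)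
  have hV : 0 < V := volume_real_ball_pos one_pos
  have h0 := (tendsto_measure_le_norm_zero (densityMeasure q) 1).const_mul (2 / V)
  rw [mul_zero] at h0
  refine squeeze_zero' (Eventually.of_forall fun m => (hq.pos _).le) ?_ h0
  filter_upwards [tendsto_natCast_atTop_atTop.eventually
    (hlong.eventually_ratio (fun R => hq.pos _) 1)] with m hm
  have hb := hq.le_densityMeasure_real (C := Metric.ball ((m : ℝ) • e) 1) Metric.isOpen_ball.measurableSet
    (half_pos (hq.pos ((m : ℝ) • e))).le fun y hy => by
      rw [← hq.apply_norm_smul he y]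
      exact (hm _ (abs_norm_sub_le_of_mem_ball he m.cast_nonneg hy)).1
  rw [volume_real_ball_center] at hb
  have hsub : (densityMeasure q).real (Metric.ball ((m : ℝ) • e) 1)
      ≤ (densityMeasure q).real {y | (m : ℝ) - 1 ≤ ‖y‖} := measureReal_mono fun y hy => by
    have := abs_le.1 (abs_norm_sub_le_of_mem_ball he m.cast_nonneg hy)
    exact (by linarith : (m : ℝ) - 1 ≤ ‖y‖)
  have h3 := hb.trans hsub
  rw [div_mul_eq_mul_div, le_div_iff₀ hV]
  change _ / 2 * V ≤ _ at h3
  linarith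

/-- A positive long-tailed function that tends to zero takes values comparable to `1 / n` arbitrarily
far away. -/
theorem LongTailed.eventually_exists_scale {f : ℝ → ℝ} (h : LongTailed f) (hf : ∀ R, 0 < f R)
    (h0 : Tendsto (fun m : ℕ => f m) atTop (𝓝 0)) (T : ℝ) :
    ∀ᶠ n : ℕ in atTop, ∃ R, T ≤ R ∧ 1 / 2 ≤ n * f R ∧ n * f R ≤ 1 := by
  obtain ⟨T', hT'⟩ := eventually_atTop.1 (h.eventually_ratio hf 1)
  obtain ⟨m₀, hm₀⟩ := exists_nat_ge (max T T')
  filter_upwards [(tendsto_natCast_atTop_atTop.atTop_mul_const (hf m₀)).eventually_gt_atTop 1,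
    eventually_gt_atTop 0] with n hn hn0
  have hn0' : (0 : ℝ) < n := Nat.cast_pos.2 hn0
  have hex : ∃ k : ℕ, n * f (m₀ + k : ℕ) ≤ 1 := by
    have h1 := (h0.comp (tendsto_add_atTop_nat m₀)).eventually_lt_const
      (show (0 : ℝ) < 1 / n by positivity)
    obtain ⟨k, hk⟩ := h1.exists
    refine ⟨k, ?_⟩
    rw [Function.comp_apply, lt_div_iff₀ hn0', add_comm] at hk
    linarith
  classical
  -- Take the first integer step at which `n * f` is at most 1. It is not step 0, since `n * f m₀ >
  -- 1`; the previous value exceeds 1 and at most halves.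
  obtain ⟨k, hk, hmin⟩ : ∃ k : ℕ, n * f (m₀ + k : ℕ) ≤ 1 ∧
      ∀ j < k, ¬ n * f (m₀ + j : ℕ) ≤ 1 :=
    ⟨Nat.find hex, Nat.find_spec hex, fun j hj => Nat.find_min hex hj⟩
  cases k with
  | zero => exact absurd hk (not_le.2 hn)
  | succ j =>
    have h1 := not_le.1 (hmin j (Nat.lt_succ_self j))
    have hm : max T T' ≤ (m₀ + j : ℕ) := hm₀.trans (by push_cast; linarith [j.cast_nonneg (α := ℝ)])
    have h2 := (hT' (m₀ + j : ℕ) ((le_max_right _ _).trans hm) (m₀ + (j + 1) : ℕ)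
      (by push_cast; rw [abs_le]; constructor <;> linarith)).1
    refine ⟨(m₀ + (j + 1) : ℕ), ((le_max_left _ _).trans hm).trans (by push_cast; linarith), ?_, hk⟩
    have := mul_le_mul_of_nonneg_left h2 hn0'.le
    linarith

end Density

/-! ### Test balls along a ray and conclusion -/

/-- The probability that a geometric graph of connectivity radius at most one is disconnected is
bounded below in terms of the number `K` of test balls. -/
theorem eventually_le_measure_disconnected {d : ℕ} {q : EuclideanSpace ℝ (Fin d) → ℝ}
    (hq : IsRadialDensity q) {e : EuclideanSpace ℝ (Fin d)} (he : ‖e‖ = 1)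
    (hlong : LongTailed fun R => q (R • e))
    {Ω : Type*} [MeasurableSpace Ω] (P : Measure Ω) [IsProbabilityMeasure P]
    (N : ℕ → Ω → ℕ) (X : ℕ → ℕ → Ω → EuclideanSpace ℝ (Fin d))
    (hP : ∀ n, IsPoissonSample P (densityMeasure q) n (N n) (X n))
    {r : ℕ → ℝ} (hr : ∀ n, r n ≤ 1) {δ : ℝ}
    (hδ : δ = Real.exp (-(2 * volume.real (Metric.ball (0 : EuclideanSpace ℝ (Fin d)) 2))) *
      (1 - Real.exp (-(volume.real (Metric.ball (0 : EuclideanSpace ℝ (Fin d)) (1 / 2)) / 4))))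
    {K : ℕ} (hK : 2 ≤ K * δ) :
    ∀ᶠ n in atTop, 1 - 4 / (K * δ) ≤
      P.real {ω | Disconnected (geometricGraph (pointSet (N n) (X n) ω) (r n))} := by
  have := hq.isProbabilityMeasure
  have hpos : ∀ R : ℝ, 0 < q (R • e) := fun R => hq.pos _
  -- Centres lie at radii `R + 4 * i` with `i < K` and the balls have radius 2, so all norms are
  -- within `4 * K + 2` of `R`.
  obtain ⟨T, hT⟩ := eventually_atTop.1 (hlong.eventually_ratio hpos (4 * K + 2))
  filter_upwards [hlong.eventually_exists_scale hpos (hq.tendsto_zero he hlong) (max T 0)]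
    with n ⟨R, hTR, hlow, hup⟩
  have hR0 : 0 ≤ R := (le_max_right _ _).trans hTR
  set c : Fin K → EuclideanSpace ℝ (Fin d) := fun i => (R + 4 * (i : ℕ)) • e
  set A : Fin K → Set (EuclideanSpace ℝ (Fin d)) := fun i => Metric.ball (c i) (1 / 2)
  set B : Fin K → Set (EuclideanSpace ℝ (Fin d)) := fun i => Metric.ball (c i) 2 \ A i
  have hA : ∀ i, MeasurableSet (A i) := fun i => Metric.isOpen_ball.measurableSet
  have hB : ∀ i, MeasurableSet (B i) := fun i => Metric.isOpen_ball.measurableSet.diff (hA i)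
  have hAsub : ∀ i, A i ⊆ Metric.ball (c i) 2 := fun i => Metric.ball_subset_ball (by norm_num)
  have hratio : ∀ i, ∀ y ∈ Metric.ball (c i) 2, q (R • e) / 2 ≤ q y ∧ q y ≤ 2 * q (R • e) := by
    intro i y hy
    have h1 := abs_le.1 (abs_norm_sub_le_of_mem_ball he (by positivity) hy)
    have hi : ((i : ℕ) : ℝ) ≤ K := Nat.cast_le.2 i.2.le
    have hi0 : (0 : ℝ) ≤ ((i : ℕ) : ℝ) := Nat.cast_nonneg _
    rw [← hq.apply_norm_smul he y]
    exact hT R ((le_max_left _ _).trans hTR) _ (abs_le.2 ⟨by linarith, by linarith⟩)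
  have hdisj : ∀ i j, i ≠ j → Disjoint (Metric.ball (c i) 2) (Metric.ball (c j) 2) := by
    intro i j hij
    apply Metric.ball_disjoint_ball
    have h1 : (1 : ℝ) ≤ |((i : ℕ) : ℝ) - ((j : ℕ) : ℝ)| := by
      have : (1 : ℤ) ≤ |((i : ℕ) : ℤ) - ((j : ℕ) : ℤ)| :=
        Int.one_le_abs (sub_ne_zero.2 fun h => hij (Fin.ext (by exact_mod_cast h)))
      exact_mod_cast this
    rw [dist_eq_norm, ← sub_smul, norm_smul, he, mul_one, Real.norm_eq_abs,
      show R + 4 * ((i : ℕ) : ℝ) - (R + 4 * ((j : ℕ) : ℝ)) = 4 * (((i : ℕ) : ℝ) - ((j : ℕ) : ℝ)) by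
        ring, abs_mul, abs_of_pos (four_pos (α := ℝ))]
    linarith
  -- The factor `1/4` is `1/2` from the scale of `n * q (R • e)` times `1/2` from the comparison of
  -- `q` on the ball.
  have hνA : ∀ i, volume.real (Metric.ball (0 : EuclideanSpace ℝ (Fin d)) (1 / 2)) / 4
      ≤ n * (densityMeasure q).real (A i) := by
    intro i
    have h1 := hq.le_densityMeasure_real (hA i) (half_pos (hpos R)).le
      fun y hy => (hratio i y (hAsub i hy)).1
    rw [volume_real_ball_center] at h1
    have h2 := mul_le_mul_of_nonneg_left h1 n.cast_nonneg
    have h3 := mul_le_mul_of_nonneg_right hlow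
      (volume_real_ball_pos (d := d) (half_pos (one_pos (α := ℝ)))).le
    linarith
  have hνB : ∀ i, n * (densityMeasure q).real (B i)
      ≤ 2 * volume.real (Metric.ball (0 : EuclideanSpace ℝ (Fin d)) 2) := by
    intro i
    have h1 := densityMeasure_real_le (C := Metric.ball (c i) 2) Metric.isOpen_ball.measurableSet
      measure_ball_lt_top.ne (mul_pos two_pos (hpos R)).le fun y hy => (hratio i y hy).2
    rw [volume_real_ball_center] at h1
    have h2 := mul_le_mul_of_nonneg_left
      ((measureReal_mono (Set.sdiff_subset (t := A i))).trans h1)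
      (n.cast_nonneg (α := ℝ))
    have h3 := mul_le_mul_of_nonneg_right hup (volume_real_ball_pos (d := d) two_pos).le
    exact h2.trans (by linarith)
  have htwo := measureReal_two_occur (P := P) (E := fun i => hit (N n) (X n) (A i) (B i))
    (fun i => measurableSet_hit (hP n) (hA i) (hB i))
    (fun i j hij => measureReal_hit_inter (hP n) (hA i) (hB i) (hA j) (hB j)
      ((hdisj i j hij).mono (Set.union_subset (hAsub i) Set.sdiff_subset)
        (Set.union_subset (hAsub j) Set.sdiff_subset)))
    (δ := δ) (fun i => by
      rw [measureReal_hit (hP n) (hA i) (hB i) Set.disjoint_sdiff_right, hδ]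
      have hV := volume_real_ball_pos (d := d) (half_pos (one_pos (α := ℝ)))
      refine mul_le_mul (Real.exp_le_exp.2 (neg_le_neg (hνB i)))
        (sub_le_sub_left (Real.exp_le_exp.2 (neg_le_neg (hνA i))) 1) ?_ (Real.exp_pos _).le
      rw [sub_nonneg, Real.exp_le_one_iff]
      linarith) hK
  refine htwo.trans (measureReal_mono fun ω hω => ?_)
  simp only [Set.mem_iUnion, Set.mem_inter_iff] at hω
  obtain ⟨i, j, hij, hi, hj⟩ := hω
  exact disconnected_of_hit (hr n) (hdisj i j hij) hi hj

/-- Since `δ` does not depend on `K`, the error `4 / (K * δ)` can be made arbitrarily small before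
`n` tends to infinity. -/
theorem withHighProbability_disconnected {d : ℕ} {q : EuclideanSpace ℝ (Fin d) → ℝ}
    (hq : IsRadialDensity q) {e : EuclideanSpace ℝ (Fin d)} (he : ‖e‖ = 1)
    (hlong : LongTailed fun R => q (R • e))
    {Ω : Type*} [MeasurableSpace Ω] (P : Measure Ω) [IsProbabilityMeasure P]
    (N : ℕ → Ω → ℕ) (X : ℕ → ℕ → Ω → EuclideanSpace ℝ (Fin d))
    (hP : ∀ n, IsPoissonSample P (densityMeasure q) n (N n) (X n))
    {r : ℕ → ℝ} (hr : ∀ n, r n ≤ 1) :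
    WithHighProbability P
      fun n => {ω | Disconnected (geometricGraph (pointSet (N n) (X n) ω) (r n))} := by
  obtain ⟨δ, hδ⟩ : ∃ δ, δ = Real.exp
      (-(2 * volume.real (Metric.ball (0 : EuclideanSpace ℝ (Fin d)) 2))) *
      (1 - Real.exp (-(volume.real (Metric.ball (0 : EuclideanSpace ℝ (Fin d)) (1 / 2)) / 4))) :=
    ⟨_, rfl⟩
  have hδ0 : 0 < δ := by
    have hV := volume_real_ball_pos (d := d) (half_pos (one_pos (α := ℝ)))
    rw [hδ]
    refine mul_pos (Real.exp_pos _) ?_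
    rw [sub_pos, Real.exp_lt_one_iff]
    linarith
  have hreal : Tendsto (fun n => P.real
      {ω | Disconnected (geometricGraph (pointSet (N n) (X n) ω) (r n))}) atTop (𝓝 1) := by
    refine tendsto_order.2 ⟨fun a ha => ?_, fun a ha =>
      Eventually.of_forall fun n => measureReal_le_one.trans_lt ha⟩
    have hKt : Tendsto (fun K : ℕ => (K : ℝ) * δ) atTop atTop :=
      tendsto_natCast_atTop_atTop.atTop_mul_const hδ0
    have hK4 := (hKt.const_div_atTop 4).const_sub 1
    rw [sub_zero] at hK4
    obtain ⟨K, hK2, hKa⟩ := ((hKt.eventually_ge_atTop 2).and (hK4.eventually_const_lt ha)).exists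
    filter_upwards [eventually_le_measure_disconnected hq he hlong P N X hP hr hδ hK2] with n hn
    exact hKa.trans_le hn
  have := ENNReal.tendsto_ofReal hreal
  simpa [WithHighProbability] using this

end RGG

theorem mainTheorem2 {d : ℕ} (hd : 2 ≤ d) (q : EuclideanSpace ℝ (Fin d) → ℝ)
    (hq : RGG.IsRadialDensity q) (hdecay : RGG.HasSubexponentialDecay q)
    {Ω : Type*} [MeasurableSpace Ω] (P : Measure Ω) [IsProbabilityMeasure P]
    (N : ℕ → Ω → ℕ) (X : ℕ → ℕ → Ω → EuclideanSpace ℝ (Fin d))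
    (hP : ∀ n, RGG.IsPoissonSample P (RGG.densityMeasure q) n (N n) (X n)) :
    RGG.WithHighProbability P
        (fun n => {ω | RGG.Disconnected
          (RGG.geometricGraph (RGG.pointSet (N n) (X n) ω) 1)}) ∧
      ∀ r : ℕ → ℝ, (∀ n, 0 < r n) → (∀ n, r n ≤ 1) →
        RGG.WithHighProbability P
          (fun n => {ω | RGG.Disconnected
            (RGG.geometricGraph (RGG.pointSet (N n) (X n) ω) (r n))}) := by
  -- By radiality any unit vector serves as the direction of the ray.
  have he : ‖EuclideanSpace.single (⟨0, by omega⟩ : Fin d) (1 : ℝ)‖ = 1 := by simp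
  have hlong := hdecay.longTailed hq he
  exact ⟨RGG.withHighProbability_disconnected hq he hlong P N X hP (r := fun _ => 1) fun _ => le_rfl,
    fun r _ hr => RGG.withHighProbability_disconnected hq he hlong P N X hP hr⟩
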